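/- A subset $\Lambda$ of $\mathbb{R}^n$ is an approximate subgroup if $0\in\Lambda$, $\Lambda=-\Lambda$ and $\Lambda+\Lambda\subset F+\Lambda$ for some finite $F\subset\mathbb{R}^n$; two subsets $X,Y$ are commensurable if $X\subset F+Y$ and $Y\subset F+X$ for some finite $F$; an approximate subgroup $\Lambda$ is uniformly discrete if $0$ is isolated in $\Lambda-\Lambda$. Let $\Lambda$ be a closed approximate subgroup of $\mathbb{R}^n$. There are vector subspaces $V_o$ and $V_d$ of $\mathbb{R}^n$ with $V_o\oplus V_d=\mathbb{R}^n$, a uniformly discrete approximate subgroup $\Lambda_d\subset V_d$ and a compact approximate subgroup $K\subset V_d$ such that $\Lambda$ is commensurable to $V_o+\Lambda_d+K$. Furthermore, $V_o$, $V_d$ and $\Lambda_d$ can be chosen such that the following two properties hold as well. 1. There is a vector subspace $V_e\subset V_d$ with $V_e\cap(\Lambda_d+\Lambda_d)=\{0\}$ such that, for every compact neighbourhood $K$ of $0$ in $V_e$, $\Lambda$ is commensurable to $V_o+\Lambda_d+K$; moreover every such $K$ with $K=-K$ is an approximate subgroup. 2. There are an integer $m\ge 0$, a linear map $\phi:\mathbb{R}^m\to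 V_d$ and a vector subspace $V_d'\subset\mathbb{R}^m$ with $V_d'\cap\ker\phi=\{0\}$ such that $\Lambda_d$ is contained in and commensurable to $\phi\left(\mathbb{Z}^m\cap\left(V_d'+[-1,1]^m\right)\right)$. -/

import Mathlib

open Set Topology
open scoped Pointwise

/-- A subset of an additive group is an approximate subgroup if it contains `0`, is symmetric, and
its double is covered by finitely many of its translates (with no control on their number). -/
def IsApproxSubgroup {E : Type*} [AddGroup E] (A : Set E) : Prop :=
  ∃ C : ℝ, IsApproximateAddSubgroup C A

/-- Two subsets of an additive group are commensurable if each one is covered by finitely many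
translates of the other one. -/
def AreCommensurable {E : Type*} [AddGroup E] (X Y : Set E) : Prop :=
  ∃ F : Set E, F.Finite ∧ X ⊆ F + Y ∧ Y ⊆ F + X

/-- A (nonempty) subset `A` is uniformly discrete if `0` is isolated in the difference set
`-A + A`. -/
def IsUniformlyDiscrete {E : Type*} [AddGroup E] [TopologicalSpace E] (A : Set E) : Prop :=
  ∃ U ∈ 𝓝 (0 : E), (-A + A) ∩ U = {0}

/-- The integer points of `ℝ^m` lying in `W + [-1, 1]^m`. -/
def integerPointsNear {m : ℕ} (W : Submodule ℝ (Fin m → ℝ)) : Set (Fin m → ℝ) :=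
  Set.range (fun (z : Fin m → ℤ) (i : Fin m) => (z i : ℝ)) ∩
    ((W : Set (Fin m → ℝ)) + Set.Icc (fun _ => (-1 : ℝ)) (fun _ => (1 : ℝ)))

/-! ### Coarse geometry: Schreiber's theorem. -/

section Coarse

/-! Two linear structures describe a closed approximate subgroup `L`, one local and one coarse.
Locally, `L + L` is closed under addition near `0`: `L + L + (L + L)` lies in finitely many
translates `f + L`, and those coming near `0` have `f ∈ L`. Hence `L + L` coincides near `0` with a
subspace `T` (`IsApproxSubgroup.exists_tangentSpace`). Coarsely, `L` is at bounded distance from a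
subspace (`exists_submodule_near`); walking along it in unit steps shows that `L` generates a
finitely generated group modulo `T`. So `L` lifts injectively to `T × ℤ^m`. Schreiber's theorem,
applied to the lift, gives a subspace `Q` of `T × ℝ^m` that meets the kernel of the projection to
`E` trivially (`IsApproxSubgroup.exists_lifted_submodule`). Then `Vo = Q ∩ T`, `W` is the projection
of `Q` to `ℝ^m`, and modulo `Vo` the space `Q` is a graph over `W`. Mapping `ℤ^m` to `E` along this
graph, then onto a complement `Vd` of `Vo`, gives `φ`. It is injective on `W`, so the image of the
integer points near `W` is uniformly discrete. The remaining errors are bounded and lie in `Ve = Vd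
∩ T`, where a compact neighbourhood of `0` absorbs them (`IsApproxSubgroup.exists_splitting`). -/

theorem Bornology.IsBounded.exists_finite_net {X : Type*} [SeminormedAddCommGroup X] [ProperSpace X]
    {s : Set X} (hs : Bornology.IsBounded s) {ε : ℝ} (hε : 0 < ε) :
    ∃ t ⊆ s, t.Finite ∧ ∀ x ∈ s, ∃ y ∈ t, ‖x - y‖ < ε := by
  obtain ⟨t, hts, htf, hcov⟩ := totallyBounded_iff_subset.mp
    (hs.isCompact_closure.totallyBounded.subset subset_closure) _ (Metric.dist_mem_uniformity hε)
  refine ⟨t, hts, htf, fun x hx => ?_⟩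
  obtain ⟨y, hy, hxy⟩ := mem_iUnion₂.mp (hcov hx)
  exact ⟨y, hy, by simpa [dist_eq_norm] using hxy⟩

variable {E : Type*} [NormedAddCommGroup E] [InnerProductSpace ℝ E] [FiniteDimensional ℝ E]

/-- A coarse approximate subgroup on which no nonzero functional is bounded is relatively dense. -/
theorem exists_norm_sub_le_of_inner_unbounded {A : Set E} {C : ℝ}
    (hneg : ∀ a ∈ A, -a ∈ A) (h0 : (0 : E) ∈ A)
    (hadd : ∀ a ∈ A, ∀ b ∈ A, ∃ c ∈ A, ‖a + b - c‖ ≤ C)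
    (hunb : ∀ u : E, u ≠ 0 → ∀ M : ℝ, ∃ a ∈ A, M < |inner ℝ u a|) :
    ∃ R : ℝ, ∀ v : E, ∃ a ∈ A, ‖v - a‖ ≤ R := by
  wlog hC : 0 < C generalizing C
  · exact this (C := |C| + 1) (fun a ha b hb => by
      obtain ⟨c, hc, h⟩ := hadd a ha b hb
      exact ⟨c, hc, h.trans (by linarith [le_abs_self C])⟩) (by positivity)
  -- Compactness of the sphere makes the length bound `l` uniform in the direction `u`. Of the
  -- margin `3 * C`, one `C` pays for the quadratic term `‖b‖ ^ 2`, one for replacing `a + b` by an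
  -- element of `A`, and one is the gain.
  let U : ℕ → Set E := fun l => ⋃ a ∈ {a | a ∈ A ∧ ‖a‖ ≤ l}, {u | 3 * C < inner ℝ u a}
  have hUo : ∀ l, IsOpen (U l) := fun l => isOpen_biUnion fun a _ =>
    isOpen_lt continuous_const (by fun_prop)
  have hcov : Metric.sphere (0 : E) 1 ⊆ ⋃ l, U l := by
    intro u hu
    have hu0 : u ≠ 0 := by rintro rfl; simp at hu
    obtain ⟨a, ha, hau⟩ := hunb u hu0 (3 * C)
    obtain ⟨l, hl⟩ := exists_nat_ge ‖a‖
    refine mem_iUnion.mpr ⟨l, mem_iUnion₂.mpr ?_⟩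
    rcases lt_abs.mp hau with h | h
    · exact ⟨a, ⟨ha, hl⟩, h⟩
    · exact ⟨-a, ⟨hneg a ha, by simpa using hl⟩, by simpa [inner_neg_right] using h⟩
  have hmono : Monotone U := fun l k hlk u hu => by
    obtain ⟨a, ⟨ha, hal⟩, h⟩ := mem_iUnion₂.mp hu
    exact mem_iUnion₂.mpr ⟨a, ⟨ha, hal.trans (by exact_mod_cast hlk)⟩, h⟩
  obtain ⟨l, hl⟩ := (isCompact_sphere (0 : E) 1).elim_directed_cover U hUo hcov hmono.directed_le
  -- Beyond this distance `l ^ 2 ≤ 2 * C * ‖d‖` and `2 * C ≤ ‖d‖`, as the square comparison below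
  -- needs.
  set R : ℝ := (l : ℝ) ^ 2 / (2 * C) + 2 * C with hR
  have hRpos : 0 < R := by positivity
  have key : ∀ v : E, ∀ a ∈ A, R < ‖v - a‖ → ∃ b ∈ A, ‖v - b‖ ≤ ‖v - a‖ - C := by
    intro v a ha hRa
    set d := v - a with hd
    have hdpos : 0 < ‖d‖ := hRpos.trans hRa
    have hu : ‖d‖⁻¹ • d ∈ Metric.sphere (0 : E) 1 := by
      simp [norm_smul, hdpos.ne']
    obtain ⟨b, ⟨hb, hbl⟩, hub⟩ := mem_iUnion₂.mp (hl hu)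
    have hub' : 3 * C * ‖d‖ < inner ℝ d b := by
      have : 3 * C < ‖d‖⁻¹ * inner ℝ d b := by simpa [real_inner_smul_left] using hub
      rw [inv_mul_eq_div, lt_div_iff₀ hdpos] at this
      exact this
    obtain ⟨c, hc, hcab⟩ := hadd a ha b hb
    refine ⟨c, hc, ?_⟩
    have h1 : ‖d - b‖ ≤ ‖d‖ - 2 * C := by
      apply le_of_sq_le_sq _ (by
        have : 0 ≤ (l : ℝ) ^ 2 / (2 * C) := by positivity
        linarith)
      rw [norm_sub_sq_real]
      have h2 : ‖b‖ ^ 2 ≤ (l : ℝ) ^ 2 := by gcongr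
      have h3 : (l : ℝ) ^ 2 ≤ 2 * C * ‖d‖ := by
        have : (l : ℝ) ^ 2 / (2 * C) ≤ ‖d‖ := by linarith
        rw [div_le_iff₀ (by positivity)] at this
        linarith
      nlinarith
    calc ‖v - c‖ = ‖(d - b) + (a + b - c)‖ := by congr 1; rw [hd]; abel
      _ ≤ ‖d - b‖ + ‖a + b - c‖ := norm_add_le _ _
      _ ≤ ‖d‖ - C := by linarith
  refine ⟨R, fun v => ?_⟩
  by_contra! hcon
  have hdesc : ∀ k : ℕ, ∃ a ∈ A, ‖v - a‖ ≤ ‖v‖ - k * C := by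
    intro k
    induction k with
    | zero => exact ⟨0, h0, by simp⟩
    | succ k ih =>
      obtain ⟨a, ha, hva⟩ := ih
      obtain ⟨b, hb, hvb⟩ := key v a ha (hcon a ha)
      exact ⟨b, hb, by push_cast; linarith⟩
  obtain ⟨k, hk⟩ := exists_nat_gt (‖v‖ / C)
  obtain ⟨a, -, hva⟩ := hdesc k
  rw [div_lt_iff₀ hC] at hk
  linarith [norm_nonneg (v - a)]

/-- **Schreiber's theorem** in Euclidean form: a coarse approximate subgroup is at bounded distance
from a vector subspace. -/
theorem exists_submodule_near_inner {A : Set E} {C : ℝ}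
    (hneg : ∀ a ∈ A, -a ∈ A) (h0 : (0 : E) ∈ A)
    (hadd : ∀ a ∈ A, ∀ b ∈ A, ∃ c ∈ A, ‖a + b - c‖ ≤ C) :
    ∃ (V : Submodule ℝ E) (R : ℝ),
      (∀ a ∈ A, ∃ v ∈ V, ‖a - v‖ ≤ R) ∧ ∀ v ∈ V, ∃ a ∈ A, ‖v - a‖ ≤ R := by
  -- Take `V` minimal among the subspaces near `A`: a functional bounded on the projection of `A`
  -- would allow `V` to be replaced by a hyperplane of `V`.
  obtain ⟨V, ⟨R₁, hR₁⟩, hmin⟩ := WellFounded.has_min (wellFounded_lt (α := Submodule ℝ E))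
    {V | ∃ R : ℝ, ∀ a ∈ A, ∃ v ∈ V, ‖a - v‖ ≤ R} ⟨⊤, 0, fun a _ => ⟨a, by simp, by simp⟩⟩
  let p := V.orthogonalProjectionOnto
  have hpn : ∀ x : E, ‖p x‖ ≤ ‖x‖ := V.norm_orthogonalProjectionOnto_apply_le
  have hunb : ∀ u : V, u ≠ 0 → ∀ M : ℝ, ∃ a ∈ p '' A, M < |inner ℝ u a| := by
    intro u hu M
    by_contra! hcon
    have hupos : 0 < ‖u‖ := norm_pos_iff.mpr hu
    refine hmin (V ⊓ (ℝ ∙ (u : E))ᗮ) ⟨R₁ + (M + ‖u‖ * R₁) / ‖u‖, fun a ha => ?_⟩ ?_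
    · obtain ⟨v, hv, hav⟩ := hR₁ a ha
      have huv : |inner ℝ (u : E) v| ≤ M + ‖u‖ * R₁ := by
        have h1 : |inner ℝ (u : E) a| ≤ M := by
          have := hcon (p a) ⟨a, ha, rfl⟩
          rwa [show inner ℝ u (p a) = inner ℝ (u : E) a from
            Submodule.inner_orthogonalProjectionOnto_eq_of_mem_left u a] at this
        have h2 : |inner ℝ (u : E) (a - v)| ≤ ‖u‖ * R₁ :=
          (abs_real_inner_le_norm _ _).trans (by gcongr; exact le_of_eq rfl)
        rw [inner_sub_right] at h2
        rw [abs_le] at *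
        constructor <;> linarith
      refine ⟨v - (inner ℝ (u : E) v / ‖u‖ ^ 2) • (u : E), ⟨V.sub_mem hv (V.smul_mem _ u.2), ?_⟩, ?_⟩
      · rw [SetLike.mem_coe, Submodule.mem_orthogonal_singleton_iff_inner_right, inner_sub_right,
          inner_smul_right, real_inner_self_eq_norm_sq]
        have : ‖(u : E)‖ ≠ 0 := by simpa using hu
        rw [Submodule.coe_norm]
        field_simp
        simp
      · calc _ = ‖(a - v) + (inner ℝ (u : E) v / ‖u‖ ^ 2) • (u : E)‖ := by congr 1; abel
          _ ≤ ‖a - v‖ + ‖(inner ℝ (u : E) v / ‖u‖ ^ 2) • (u : E)‖ := norm_add_le _ _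
          _ = ‖a - v‖ + |inner ℝ (u : E) v| / ‖u‖ := by
            rw [norm_smul, Real.norm_eq_abs, abs_div, abs_of_nonneg (sq_nonneg ‖u‖),
              Submodule.coe_norm]
            have : ‖(u : E)‖ ≠ 0 := by simpa using hu
            field_simp
          _ ≤ _ := by gcongr
    · refine lt_of_le_of_ne inf_le_left fun h => hu ?_
      have : (u : E) ∈ V ⊓ (ℝ ∙ (u : E))ᗮ := h.symm.le u.2
      have := (Submodule.mem_orthogonal_singleton_iff_inner_right.mp this.2)
      simpa using this
  obtain ⟨R₂, hR₂⟩ := exists_norm_sub_le_of_inner_unbounded (A := p '' A) (C := C)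
    (by rintro _ ⟨a, ha, rfl⟩; exact ⟨-a, hneg a ha, by simp⟩) ⟨0, h0, by simp⟩
    (by
      rintro _ ⟨a, ha, rfl⟩ _ ⟨b, hb, rfl⟩
      obtain ⟨c, hc, h⟩ := hadd a ha b hb
      refine ⟨p c, ⟨c, hc, rfl⟩, ?_⟩
      rw [← map_add, ← map_sub]
      exact (hpn _).trans h) hunb
  have hpa : ∀ a ∈ A, ‖a - p a‖ ≤ 2 * R₁ := by
    intro a ha
    obtain ⟨v, hv, hav⟩ := hR₁ a ha
    have hpv : (p v : E) = v := V.starProjection_eq_self_iff.mpr hv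
    calc ‖a - p a‖ = ‖(a - v) - (p (a - v) : V)‖ := by
          congr 1; rw [map_sub, Submodule.coe_sub, hpv]; abel
      _ ≤ ‖a - v‖ + ‖p (a - v)‖ := norm_sub_le _ _
      _ ≤ 2 * R₁ := by linarith [hpn (a - v)]
  refine ⟨V, max (2 * R₁) (R₂ + 2 * R₁),
    fun a ha => ⟨p a, (p a).2, (hpa a ha).trans (le_max_left _ _)⟩,
    fun v hv => ?_⟩
  obtain ⟨_, ⟨a, ha, rfl⟩, h⟩ := hR₂ ⟨v, hv⟩
  refine ⟨a, ha, le_trans ?_ (le_max_right _ _)⟩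
  have h' : ‖v - p a‖ ≤ R₂ := h
  calc ‖v - a‖ = ‖(v - p a) - (a - p a)‖ := by congr 1; abel
    _ ≤ ‖v - p a‖ + ‖a - p a‖ := norm_sub_le _ _
    _ ≤ R₂ + 2 * R₁ := add_le_add h' (hpa a ha)

/-- **Schreiber's theorem**: a coarse approximate subgroup of a finite-dimensional space is at
bounded distance from a vector subspace. -/
theorem exists_submodule_near {X : Type*} [NormedAddCommGroup X] [NormedSpace ℝ X]
    [FiniteDimensional ℝ X] {A : Set X} {C : ℝ}
    (hneg : ∀ a ∈ A, -a ∈ A) (h0 : (0 : X) ∈ A)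
    (hadd : ∀ a ∈ A, ∀ b ∈ A, ∃ c ∈ A, ‖a + b - c‖ ≤ C) :
    ∃ (V : Submodule ℝ X) (R : ℝ),
      (∀ a ∈ A, ∃ v ∈ V, ‖a - v‖ ≤ R) ∧ ∀ v ∈ V, ∃ a ∈ A, ‖v - a‖ ≤ R := by
  let e : X ≃L[ℝ] EuclideanSpace ℝ (Fin (Module.finrank ℝ X)) := toEuclidean
  obtain ⟨c₁, hc₁⟩ : ∃ c : ℝ, ∀ x, ‖e x‖ ≤ c * ‖x‖ := ⟨_, e.toContinuousLinearMap.le_opNorm⟩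
  obtain ⟨c₂, hc₂⟩ : ∃ c : ℝ, ∀ x, ‖e.symm x‖ ≤ c * ‖x‖ :=
    ⟨_, e.symm.toContinuousLinearMap.le_opNorm⟩
  obtain ⟨V, R, hV₁, hV₂⟩ := exists_submodule_near_inner (A := e '' A) (C := |c₁| * C)
    (by rintro _ ⟨a, ha, rfl⟩; exact ⟨-a, hneg a ha, by simp⟩) ⟨0, h0, by simp⟩
    (by
      rintro _ ⟨a, ha, rfl⟩ _ ⟨b, hb, rfl⟩
      obtain ⟨c, hc, h⟩ := hadd a ha b hb
      refine ⟨e c, ⟨c, hc, rfl⟩, ?_⟩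
      rw [← map_add, ← map_sub]
      refine (hc₁ _).trans ?_
      calc c₁ * ‖a + b - c‖ ≤ |c₁| * ‖a + b - c‖ := by gcongr; exact le_abs_self _
        _ ≤ _ := by gcongr)
  have hsymm : ∀ x y : X, ‖e x - e y‖ ≤ R → ‖x - y‖ ≤ |c₂| * R := fun x y h => by
    calc ‖x - y‖ = ‖e.symm (e x - e y)‖ := by simp
      _ ≤ c₂ * ‖e x - e y‖ := hc₂ _
      _ ≤ |c₂| * ‖e x - e y‖ := by gcongr; exact le_abs_self _
      _ ≤ |c₂| * R := by gcongr
  refine ⟨V.comap (e : X →ₗ[ℝ] _), |c₂| * R, fun a ha => ?_, fun v hv => ?_⟩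
  · obtain ⟨v, hv, h⟩ := hV₁ (e a) ⟨a, ha, rfl⟩
    exact ⟨e.symm v, by simpa using hv, hsymm _ _ (by simpa using h)⟩
  · obtain ⟨_, ⟨a, ha, rfl⟩, h⟩ := hV₂ (e v) hv
    exact ⟨a, ha, hsymm _ _ h⟩

end Coarse

/-! ### Sums of several copies of an approximate subgroup. -/

section ApproxSubgroup

variable {E : Type*} [AddCommGroup E]

theorem IsApproxSubgroup.zero_mem {A : Set E} (hA : IsApproxSubgroup A) : (0 : E) ∈ A :=
  hA.choose_spec.zero_mem

theorem IsApproxSubgroup.neg_mem {A : Set E} (hA : IsApproxSubgroup A) {a : E} (ha : a ∈ A) :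
    -a ∈ A := by
  have := hA.choose_spec.neg_eq_self
  rw [← this]
  simpa using ha

theorem IsApproxSubgroup.exists_finite {A : Set E} (hA : IsApproxSubgroup A) :
    ∃ F : Set E, F.Finite ∧ A + A ⊆ F + A := by
  obtain ⟨C, hC⟩ := hA
  obtain ⟨F, -, hF⟩ := hC.two_nsmul_covByVAdd
  refine ⟨F, F.finite_toSet, ?_⟩
  rw [two_nsmul] at hF
  exact hF

theorem isApproxSubgroup_of_finite {A F : Set E} (h0 : (0 : E) ∈ A) (hneg : -A = A)
    (hF : F.Finite) (hAF : A + A ⊆ F + A) : IsApproxSubgroup A :=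
  ⟨hF.toFinset.card, h0, hneg, hF.toFinset, le_rfl, by
    rw [two_nsmul, hF.coe_toFinset]
    exact hAF⟩

theorem IsApproxSubgroup.exists_finite_three {A : Set E} (hA : IsApproxSubgroup A) :
    ∃ F : Set E, F.Finite ∧ A + A + A ⊆ F + A := by
  obtain ⟨F, hF, h⟩ := hA.exists_finite
  refine ⟨F + F, hF.add hF, ?_⟩
  calc A + A + A ⊆ F + A + A := by gcongr
    _ = F + (A + A) := add_assoc _ _ _
    _ ⊆ F + (F + A) := by gcongr
    _ = F + F + A := (add_assoc _ _ _).symm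

theorem IsApproxSubgroup.exists_finite_four {A : Set E} (hA : IsApproxSubgroup A) :
    ∃ F : Set E, F.Finite ∧ A + A + (A + A) ⊆ F + A := by
  obtain ⟨F, hF, h⟩ := hA.exists_finite
  obtain ⟨F', hF', h'⟩ := hA.exists_finite_three
  refine ⟨F + F', hF.add hF', ?_⟩
  calc A + A + (A + A) = A + A + A + A := by rw [add_assoc, add_assoc, add_assoc]
    _ ⊆ F' + A + A := by gcongr
    _ = F' + (A + A) := add_assoc _ _ _
    _ ⊆ F' + (F + A) := by gcongr
    _ = F + F' + A := by rw [← add_assoc, add_comm F']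

end ApproxSubgroup

/-! ### Local structure: the tangent space. -/

section Local

variable {E : Type*} [NormedAddCommGroup E]

/-- Near `0`, finitely many translates of a closed set `L` are contained in the difference set of
`L`. -/
theorem IsClosed.exists_add_mem_of_norm_lt {L F : Set E} (hL : IsClosed L)
    (hneg : ∀ x ∈ L, -x ∈ L) (hF : F.Finite) :
    ∃ ε > 0, ∀ x ∈ F + L, ‖x‖ < ε → x ∈ L + L := by
  have hcl : IsClosed (⋃ f ∈ F \ L, ({f} : Set E) + L) :=
    hF.sdiff.isClosed_biUnion fun f _ => by
      rw [singleton_add]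
      exact (Homeomorph.addLeft f).isClosedMap _ hL
  have h0 : (0 : E) ∉ ⋃ f ∈ F \ L, ({f} : Set E) + L := by
    simp only [mem_iUnion, singleton_add, not_exists]
    rintro f ⟨-, hf⟩ ⟨l, hl, h⟩
    exact hf (by rw [eq_neg_of_add_eq_zero_left h]; exact hneg l hl)
  obtain ⟨ε, hε, hball⟩ := Metric.isOpen_iff.mp hcl.isOpen_compl 0 h0
  refine ⟨ε, hε, ?_⟩
  rintro _ ⟨f, hf, l, hl, rfl⟩ hx
  by_cases hfL : f ∈ L
  · exact ⟨f, hfL, l, hl, rfl⟩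
  · exact absurd (mem_iUnion₂.mpr ⟨f, ⟨hf, hfL⟩, add_mem_add (mem_singleton f) hl⟩)
      (hball (mem_ball_zero_iff.mpr hx))

variable [InnerProductSpace ℝ E]

/-- The norms of the partial sums increase, so none leaves the ball before the last one. -/
theorem nsmul_mem_of_local_add {A : Set E} {ε : ℝ} (h0 : (0 : E) ∈ A)
    (hadd : ∀ x ∈ A, ∀ y ∈ A, ‖x + y‖ < ε → x + y ∈ A) {y : E} (hy : y ∈ A) :
    ∀ k : ℕ, ‖(k : ℝ) • y‖ < ε → (k : ℝ) • y ∈ A := by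
  intro k
  induction k with
  | zero => simpa using fun _ => h0
  | succ k ih =>
    intro hk
    have hle : ‖(k : ℝ) • y‖ ≤ ‖((k + 1 : ℕ) : ℝ) • y‖ := by
      rw [norm_smul, norm_smul]
      gcongr
      simp
      rw [abs_of_nonneg (by positivity)]
      linarith
    have heq : ((k + 1 : ℕ) : ℝ) • y = (k : ℝ) • y + y := by push_cast; module
    rw [heq] at hk ⊢
    rw [heq] at hle
    exact hadd _ (ih (hle.trans_lt hk)) _ hy hk

/-- The tangent space of a local subgroup. -/
def localTangentSpace (A : Set E) (ε : ℝ) (hε : 0 < ε) (h0 : (0 : E) ∈ A)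
    (hadd : ∀ x ∈ A, ∀ y ∈ A, ‖x + y‖ < ε → x + y ∈ A) : Submodule ℝ E where
  carrier := {v | ∀ t : ℝ, ‖t • v‖ < ε → t • v ∈ A}
  zero_mem' t := by simpa using fun _ => h0
  smul_mem' c v hv t ht := by
    rw [smul_smul] at ht ⊢
    exact hv _ ht
  add_mem' {v w} hv hw t ht := by
    -- Addition is available only near `0`: divide by a large `k`, add, then multiply back by `k`.
    obtain ⟨k, hk⟩ := exists_nat_gt ((‖t • v‖ + ‖t • w‖) / ε)
    have hk0 : (0 : ℝ) < k := lt_of_le_of_lt (by positivity) hk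
    rw [div_lt_iff₀ hε] at hk
    have hsmall : ∀ u : E, ‖t • u‖ < k * ε → ‖(t / k) • u‖ < ε := fun u hu => by
      rw [div_eq_inv_mul, mul_smul, norm_smul, norm_inv, Real.norm_natCast, inv_mul_lt_iff₀ hk0]
      exact hu
    have hv' := hv (t / k) (hsmall v (by linarith [norm_nonneg (t • w)]))
    have hw' := hw (t / k) (hsmall w (by linarith [norm_nonneg (t • v)]))
    have hvw := hadd _ hv' _ hw' (by
      rw [← smul_add]
      refine hsmall _ ?_
      rw [smul_add]
      exact (norm_add_le _ _).trans_lt hk)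
    have heq : (k : ℝ) • ((t / k) • v + (t / k) • w) = t • (v + w) := by
      rw [← smul_add, smul_smul, mul_div_cancel₀ _ hk0.ne']
    rw [← heq] at ht ⊢
    exact nsmul_mem_of_local_add h0 hadd hvw k ht

variable [FiniteDimensional ℝ E]

/-- A closed local subgroup of a Euclidean space coincides with a vector subspace near `0`. -/
theorem exists_submodule_eq_near_zero {A : Set E} {ε : ℝ} (hε : 0 < ε) (h0 : (0 : E) ∈ A)
    (hneg : ∀ x ∈ A, -x ∈ A) (hadd : ∀ x ∈ A, ∀ y ∈ A, ‖x + y‖ < ε → x + y ∈ A)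
    (hcl : ∀ x ∈ closure A, ‖x‖ < ε → x ∈ A) :
    ∃ (T : Submodule ℝ E) (δ : ℝ), 0 < δ ∧ ∀ x, ‖x‖ < δ → (x ∈ A ↔ x ∈ T) := by
  let T := localTangentSpace A ε hε h0 hadd
  have hTA : ∀ x ∈ T, ‖x‖ < ε → x ∈ A := fun x hx hxε => by
    simpa using hx 1 (by simpa using hxε)
  refine ⟨T, ?_⟩
  by_contra! hcon
  -- If `A` differs from `T` arbitrarily near `0`, it has nonzero points orthogonal to `T` tending
  -- to `0`. Integer multiples of them approximate every short multiple of a limit direction `v`, so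
  -- the unit vector `v` lies in both `T` and `Tᗮ`.
  have hex : ∀ k : ℕ, ∃ y ∈ A, y ∈ Tᗮ ∧ y ≠ 0 ∧ ‖y‖ < 1 / ((k : ℝ) + 1) := by
    intro k
    obtain ⟨x, hx, h⟩ := hcon (min ε (1 / ((k : ℝ) + 1))) (by positivity)
    have hxε := hx.trans_le (min_le_left _ _)
    have h' : x ∈ A ∧ x ∉ T := by
      rcases h with h | h
      · exact h
      · exact absurd (hTA x h.2 hxε) h.1
    have hp : (T.starProjection x) ∈ A :=
      hTA _ (T.starProjection_apply_mem x) ((T.norm_starProjection_apply_le x).trans_lt hxε)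
    have hyo : x - T.starProjection x ∈ Tᗮ := T.sub_starProjection_mem_orthogonal x
    have hyn : ‖x - T.starProjection x‖ ≤ ‖x‖ := by
      have := Tᗮ.norm_starProjection_apply_le x
      rwa [Submodule.starProjection_orthogonal_val] at this
    refine ⟨x - T.starProjection x, ?_, hyo, ?_, hyn.trans_lt (hx.trans_le (min_le_right _ _))⟩
    · rw [sub_eq_add_neg] at hyn ⊢
      exact hadd _ h'.1 _ (hneg _ hp) (hyn.trans_lt hxε)
    · intro h
      exact h'.2 (by rw [sub_eq_zero.mp h]; exact T.starProjection_apply_mem x)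
  choose y hyA hyT hy0 hy using hex
  have hypos : ∀ k, 0 < ‖y k‖ := fun k => norm_pos_iff.mpr (hy0 k)
  obtain ⟨v, hv, σ, hσ, hlim⟩ := (isCompact_sphere (0 : E) 1).tendsto_subseq
    (x := fun k => ‖y k‖⁻¹ • y k) fun k => by simp [norm_smul, (hypos k).ne']
  have hv1 : ‖v‖ = 1 := by simpa using hv
  have hvo : v ∈ Tᗮ := T.isClosed_orthogonal.mem_of_tendsto hlim
    (Filter.Eventually.of_forall fun k => Tᗮ.smul_mem _ (hyT _))
  have hylim : Filter.Tendsto (fun k => ‖y (σ k)‖) Filter.atTop (𝓝 0) :=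
    squeeze_zero (fun _ => norm_nonneg _) (fun k => (hy (σ k)).le)
      (tendsto_one_div_add_atTop_nhds_zero_nat.comp hσ.tendsto_atTop)
  have habs : ∀ t : ℝ, 0 ≤ t → t < ε → t • v ∈ A := by
    intro t ht0 ht
    refine hcl _ (mem_closure_of_tendsto (b := Filter.atTop)
      (f := fun k => ((⌊t / ‖y (σ k)‖⌋₊ : ℕ) : ℝ) • y (σ k)) ?_
      (Filter.Eventually.of_forall fun k => ?_)) (by rw [norm_smul, hv1]; simpa [abs_of_nonneg ht0])
    · have hc : Filter.Tendsto (fun k => ((⌊t / ‖y (σ k)‖⌋₊ : ℕ) : ℝ) * ‖y (σ k)‖)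
          Filter.atTop (𝓝 t) := by
        refine tendsto_of_tendsto_of_tendsto_of_le_of_le (g := fun k => t - ‖y (σ k)‖)
          (h := fun _ => t) (by simpa using tendsto_const_nhds.sub hylim) tendsto_const_nhds
          (fun k => ?_) (fun k => ?_)
        · have := Nat.lt_floor_add_one (t / ‖y (σ k)‖)
          rw [div_lt_iff₀ (hypos _)] at this
          simp only
          linarith
        · have := Nat.floor_le (div_nonneg ht0 (norm_nonneg (y (σ k))))
          rwa [le_div_iff₀ (hypos _)] at this
      refine (hc.smul hlim).congr fun k => ?_
      simp only [Function.comp]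
      rw [smul_smul, mul_assoc, mul_inv_cancel₀ (hypos _).ne', mul_one]
    · refine nsmul_mem_of_local_add h0 hadd (hyA _) _ (lt_of_le_of_lt ?_ ht)
      rw [norm_smul, Real.norm_natCast]
      have := Nat.floor_le (div_nonneg ht0 (norm_nonneg (y (σ k))))
      rwa [le_div_iff₀ (hypos _)] at this
  have hvT : v ∈ T := by
    intro t ht
    rw [norm_smul, hv1, mul_one, Real.norm_eq_abs] at ht
    rcases le_total 0 t with h | h
    · exact habs t h (by rwa [abs_of_nonneg h] at ht)
    · have := hneg _ (habs (-t) (by linarith) (by rwa [abs_of_nonpos h] at ht))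
      simpa using this
  have : (inner ℝ v v : ℝ) = 0 := hvo v hvT
  rw [real_inner_self_eq_norm_sq, hv1] at this
  norm_num at this

/-- A closed approximate subgroup of a Euclidean space has a tangent space. -/
theorem IsApproxSubgroup.exists_tangentSpace {L : Set E} (hA : IsApproxSubgroup L)
    (hL : IsClosed L) :
    ∃ (T : Submodule ℝ E) (δ : ℝ), 0 < δ ∧ (∀ x ∈ T, ‖x‖ < δ → x ∈ L + L) ∧
      ∀ x ∈ L + L + (L + L), ‖x‖ < δ → x ∈ T := by
  obtain ⟨F, hF, hFL⟩ := hA.exists_finite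
  obtain ⟨F', hF', hFL'⟩ := hA.exists_finite_four
  obtain ⟨ε₁, hε₁, h₁⟩ := hL.exists_add_mem_of_norm_lt (fun x hx => hA.neg_mem hx) hF
  obtain ⟨ε₂, hε₂, h₂⟩ := hL.exists_add_mem_of_norm_lt (fun x hx => hA.neg_mem hx) hF'
  have hcl : closure (L + L) ⊆ F + L :=
    closure_minimal hFL (hL.add_left_of_isCompact hF.isCompact)
  obtain ⟨T, δ, hδ, hT⟩ := exists_submodule_eq_near_zero (A := L + L) (ε := min ε₁ ε₂)
    (by positivity) ⟨0, hA.zero_mem, 0, hA.zero_mem, by simp⟩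
    (by
      rintro _ ⟨a, ha, b, hb, rfl⟩
      exact ⟨-a, hA.neg_mem ha, -b, hA.neg_mem hb, by simp only; abel⟩)
    (fun x hx y hy hxy => h₂ _ (hFL' (add_mem_add hx hy)) (hxy.trans_le (min_le_right _ _)))
    (fun x hx hxε => h₁ _ (hcl hx) (hxε.trans_le (min_le_left _ _)))
  refine ⟨T, min δ ε₂, by positivity, fun x hx hxδ => (hT x (hxδ.trans_le (min_le_left _ _))).mpr hx,
    fun x hx hxδ => (hT x (hxδ.trans_le (min_le_left _ _))).mp
      (h₂ x (hFL' hx) (hxδ.trans_le (min_le_right _ _)))⟩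

end Local

/-! ### Integer points near a subspace. -/

section IntegerPoints

/-- The additive subgroup `ℤ^m` of `ℝ^m`. -/
def integerPoints (m : ℕ) : AddSubgroup (Fin m → ℝ) where
  carrier := Set.range (fun (z : Fin m → ℤ) (i : Fin m) => (z i : ℝ))
  zero_mem' := ⟨0, by ext; simp⟩
  add_mem' := by
    rintro _ _ ⟨a, rfl⟩ ⟨b, rfl⟩
    exact ⟨a + b, by ext; simp⟩
  neg_mem' := by
    rintro _ ⟨a, rfl⟩
    exact ⟨-a, by ext; simp⟩

variable {m : ℕ}

theorem eq_zero_of_mem_integerPoints_of_norm_lt {x : Fin m → ℝ} (hx : x ∈ integerPoints m)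
    (h : ‖x‖ < 1) : x = 0 := by
  obtain ⟨z, rfl⟩ := hx
  ext i
  have := (norm_le_pi_norm _ i).trans_lt h
  simp only [Real.norm_eq_abs] at this
  have h' : |z i| < 1 := by exact_mod_cast this
  simpa using Int.abs_lt_one_iff.mp h'

theorem finite_of_isBounded_of_subset_integerPoints {s : Set (Fin m → ℝ)}
    (hs : Bornology.IsBounded s) (hsi : s ⊆ integerPoints m) : s.Finite := by
  obtain ⟨t, hts, htf, ht⟩ := hs.exists_finite_net one_pos
  refine htf.subset fun x hx => ?_
  obtain ⟨y, hy, hxy⟩ := ht x hx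
  have := eq_zero_of_mem_integerPoints_of_norm_lt
    ((integerPoints m).sub_mem (hsi hx) (hsi (hts hy))) hxy
  rwa [sub_eq_zero.mp this]

theorem mem_integerPointsNear_iff {W : Submodule ℝ (Fin m → ℝ)} {x : Fin m → ℝ} :
    x ∈ integerPointsNear W ↔ x ∈ integerPoints m ∧ ∃ w ∈ W, ‖x - w‖ ≤ 1 := by
  have hbox : ∀ b : Fin m → ℝ,
      b ∈ Set.Icc (fun _ => (-1 : ℝ)) (fun _ => (1 : ℝ)) ↔ ‖b‖ ≤ 1 := fun b => by
    rw [pi_norm_le_iff_of_nonneg zero_le_one]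
    simp only [Set.mem_Icc, Pi.le_def, Real.norm_eq_abs, abs_le, forall_and]
  refine and_congr Iff.rfl ?_
  constructor
  · rintro ⟨w, hw, b, hb, rfl⟩
    exact ⟨w, hw, by simpa using (hbox b).mp hb⟩
  · rintro ⟨w, hw, h⟩
    exact ⟨w, hw, x - w, (hbox _).mpr h, by simp⟩

theorem zero_mem_integerPointsNear (W : Submodule ℝ (Fin m → ℝ)) : 0 ∈ integerPointsNear W :=
  mem_integerPointsNear_iff.mpr ⟨zero_mem _, 0, zero_mem _, by simp⟩

theorem neg_mem_integerPointsNear {W : Submodule ℝ (Fin m → ℝ)} {x : Fin m → ℝ}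
    (hx : x ∈ integerPointsNear W) : -x ∈ integerPointsNear W := by
  obtain ⟨hx, w, hw, h⟩ := mem_integerPointsNear_iff.mp hx
  refine mem_integerPointsNear_iff.mpr ⟨neg_mem hx, -w, neg_mem hw, ?_⟩
  rwa [← norm_neg, show -(-x - -w) = x - w by abel]

theorem add_mem_near {W : Submodule ℝ (Fin m → ℝ)} {x y : Fin m → ℝ}
    (hx : x ∈ integerPointsNear W) (hy : y ∈ integerPointsNear W) :
    x + y ∈ integerPoints m ∧ ∃ w ∈ W, ‖x + y - w‖ ≤ 2 := by
  obtain ⟨hx, v, hv, h⟩ := mem_integerPointsNear_iff.mp hx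
  obtain ⟨hy, w, hw, h'⟩ := mem_integerPointsNear_iff.mp hy
  refine ⟨add_mem hx hy, v + w, add_mem hv hw, ?_⟩
  rw [add_sub_add_comm]
  exact (norm_add_le _ _).trans (by linarith)

/-- The displacements `x - w` form a bounded set, with a finite `1`-net of displacements `f b - g b`
of the same kind; subtracting `f b` from `x` leaves a point within `1` of `W`. -/
theorem exists_finite_integerPointsNear (W : Submodule ℝ (Fin m → ℝ)) (R : ℝ) :
    ∃ F : Set (Fin m → ℝ), F.Finite ∧ ∀ x ∈ integerPoints m, (∃ w ∈ W, ‖x - w‖ ≤ R) →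
      x ∈ F + integerPointsNear W := by
  have hb : Bornology.IsBounded
      {b : Fin m → ℝ | ‖b‖ ≤ R ∧ ∃ x ∈ integerPoints m, ∃ w ∈ W, b = x - w} :=
    isBounded_iff_forall_norm_le.mpr ⟨R, fun b hb => hb.1⟩
  obtain ⟨t, hts, htf, ht⟩ := hb.exists_finite_net one_pos
  have hex : ∀ b ∈ t, ∃ x ∈ integerPoints m, ∃ w ∈ W, b = x - w := fun b hb => (hts hb).2
  choose! f hf g hg hfg using hex
  refine ⟨f '' t, htf.image f, ?_⟩
  rintro x hx ⟨w, hw, hxw⟩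
  obtain ⟨b, hbt, hb⟩ := ht (x - w) ⟨hxw, x, hx, w, hw, rfl⟩
  refine ⟨f b, ⟨b, hbt, rfl⟩, x - f b, mem_integerPointsNear_iff.mpr
    ⟨sub_mem hx (hf b hbt), w - g b, sub_mem hw (hg b hbt), ?_⟩, by simp⟩
  rw [show x - f b - (w - g b) = x - w - (f b - g b) by abel, ← hfg b hbt]
  exact hb.le

end IntegerPoints

/-! ### Lifting to `T × ℤ^r`. -/

section Lift

variable {E : Type*} [NormedAddCommGroup E] [InnerProductSpace ℝ E]

/-- An approximate subgroup lies in a subgroup generated by its tangent space and finitely many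
elements. -/
theorem IsApproxSubgroup.exists_fg_quotient [FiniteDimensional ℝ E] {L : Set E} (hA : IsApproxSubgroup L)
    {T : Submodule ℝ E} {δ : ℝ} (hδ : 0 < δ) (hT : ∀ x ∈ L + L + (L + L), ‖x‖ < δ → x ∈ T) :
    ∃ S : Set (E ⧸ T), S.Finite ∧ ∀ x ∈ L, T.mkQ x ∈ Submodule.span ℤ S := by
  obtain ⟨F, hF, hFL⟩ := hA.exists_finite
  obtain ⟨C, hC⟩ := isBounded_iff_forall_norm_le.mp hF.isBounded
  obtain ⟨V, R, hV₁, hV₂⟩ := exists_submodule_near (A := L) (C := C) (fun a ha => hA.neg_mem ha)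
    hA.zero_mem (fun a ha b hb => by
      obtain ⟨f, hf, c, hc, h⟩ := hFL (add_mem_add ha hb)
      exact ⟨c, hc, by rw [← h]; simpa using hC f hf⟩)
  have hb : Bornology.IsBounded {x ∈ L + L | ‖x‖ ≤ 2 * R + 1} :=
    isBounded_iff_forall_norm_le.mpr ⟨_, fun b hb => hb.2⟩
  obtain ⟨S, hSs, hSf, hS⟩ := hb.exists_finite_net hδ
  refine ⟨T.mkQ '' S, hSf.image _, ?_⟩
  have hneg : ∀ x ∈ L + L, -x ∈ L + L := by
    rintro _ ⟨a, ha, b, hb, rfl⟩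
    exact ⟨-a, hA.neg_mem ha, -b, hA.neg_mem hb, by simp only; abel⟩
  have hshort : ∀ x ∈ L + L, ‖x‖ ≤ 2 * R + 1 → T.mkQ x ∈ Submodule.span ℤ (T.mkQ '' S) := by
    intro x hx hxR
    obtain ⟨s, hs, hxs⟩ := hS x ⟨hx, hxR⟩
    have hmem : x - s ∈ T := hT _ (by
      rw [sub_eq_add_neg]; exact add_mem_add hx (hneg _ (hSs hs).1)) hxs
    have heq : T.mkQ x = T.mkQ s := (Submodule.Quotient.eq T).mpr hmem
    rw [heq]
    exact Submodule.subset_span ⟨s, hs, rfl⟩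
  have hR0 : 0 ≤ R := by
    obtain ⟨v, -, h⟩ := hV₁ 0 hA.zero_mem
    exact (norm_nonneg _).trans h
  -- Scaling `v` by `k / (k + 1)` moves it by at most `1`, so the points of `L` near the two vectors
  -- differ by at most `2 * R + 1`, the radius covered by `hshort`.
  have hind : ∀ k : ℕ, ∀ v ∈ V, ‖v‖ ≤ k → ∀ x ∈ L, ‖x - v‖ ≤ R →
      T.mkQ x ∈ Submodule.span ℤ (T.mkQ '' S) := by
    intro k
    induction k with
    | zero =>
      intro v hv hvk x hx hxv
      have hv0 : v = 0 := by simpa using hvk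
      subst hv0
      exact hshort x ⟨x, hx, 0, hA.zero_mem, by simp⟩ (by rw [sub_zero] at hxv; linarith)
    | succ k ih =>
      intro v hv hvk x hx hxv
      have hk : (0 : ℝ) < (k : ℝ) + 1 := by positivity
      push_cast at hvk
      obtain ⟨y, hy, hvy⟩ := hV₂ ((k / ((k : ℝ) + 1)) • v) (V.smul_mem _ hv)
      have hyq := ih ((k / ((k : ℝ) + 1)) • v) (V.smul_mem _ hv) (by
        rw [norm_smul, Real.norm_of_nonneg (by positivity), div_mul_eq_mul_div,
          div_le_iff₀ hk]
        gcongr) y hy (by rwa [norm_sub_rev])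
      have hstep : ‖v - (k / ((k : ℝ) + 1)) • v‖ ≤ 1 := by
        rw [show v - (k / ((k : ℝ) + 1)) • v = (1 / ((k : ℝ) + 1)) • v by
          rw [show (1 / ((k : ℝ) + 1)) = 1 - k / ((k : ℝ) + 1) by field_simp; ring]
          module, norm_smul, Real.norm_of_nonneg (by positivity), div_mul_eq_mul_div,
          div_le_iff₀ hk]
        linarith
      have hxy := hshort (x - y) (by
        rw [sub_eq_add_neg]; exact add_mem_add hx (hA.neg_mem hy)) (by
        calc ‖x - y‖ = ‖(x - v) + (v - (k / ((k : ℝ) + 1)) • v)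
                + ((k / ((k : ℝ) + 1)) • v - y)‖ := by congr 1; abel
          _ ≤ ‖x - v‖ + ‖v - (k / ((k : ℝ) + 1)) • v‖ + ‖(k / ((k : ℝ) + 1)) • v - y‖ :=
            norm_add₃_le
          _ ≤ _ := by linarith)
      have := add_mem hxy hyq
      rwa [← map_add, sub_add_cancel] at this
  intro x hx
  obtain ⟨v, hv, hxv⟩ := hV₁ x hx
  obtain ⟨k, hk⟩ := exists_nat_ge ‖v‖
  exact hind k v hv hk x hx hxv

/-- The linear map `T × ℝ^r → E` extending the inclusion of `T` and sending the canonical basis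
to `z`. -/
def latticeMap (T : Submodule ℝ E) {r : ℕ} (z : Fin r → E) : T × (Fin r → ℝ) →ₗ[ℝ] E :=
  T.subtype.coprod (Fintype.linearCombination ℝ z)

theorem latticeMap_apply (T : Submodule ℝ E) {r : ℕ} (z : Fin r → E) (x : T × (Fin r → ℝ)) :
    latticeMap T z x = x.1 + ∑ i, x.2 i • z i := by
  simp [latticeMap, Fintype.linearCombination_apply]

/-- The generators modulo `T` can be chosen independent over `ℤ`. -/
theorem exists_basis_of_fg_quotient {L : Set E} {T : Submodule ℝ E} {S : Set (E ⧸ T)}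
    (hS : S.Finite) (hLS : ∀ x ∈ L, T.mkQ x ∈ Submodule.span ℤ S) :
    ∃ (r : ℕ) (z : Fin r → E),
      (∀ x : T × (Fin r → ℝ), x.2 ∈ integerPoints r → latticeMap T z x ∈ T → x.2 = 0) ∧
      ∀ x ∈ L, ∃ y : T × (Fin r → ℝ), y.2 ∈ integerPoints r ∧ latticeMap T z y = x := by
  let G : Submodule ℤ (E ⧸ T) := Submodule.span ℤ S
  have : Module.Finite ℤ G := Module.Finite.span_of_finite ℤ hS
  -- A finitely generated torsion-free abelian group is free.
  have : IsAddTorsionFree (E ⧸ T) := .of_isTorsionFree ℝ (E ⧸ T)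
  have : Module.Free ℤ G := inferInstance
  let b := Module.finBasis ℤ G
  choose z hz using fun i => T.mkQ_surjective (b i : E ⧸ T)
  have hq : ∀ (t : T) (k : Fin _ → ℤ),
      T.mkQ (latticeMap T z (t, fun i => (k i : ℝ))) = (∑ i, k i • b i : G) := by
    intro t k
    rw [latticeMap_apply, map_add, map_sum]
    have h0 : T.mkQ (t : E) = 0 := (Submodule.Quotient.mk_eq_zero T).mpr t.2
    rw [h0, zero_add]
    simp [hz, Int.cast_smul_eq_zsmul]
  refine ⟨_, z, ?_, ?_⟩
  · rintro ⟨t, _⟩ ⟨k, rfl⟩ hmem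
    have h0 : T.mkQ (latticeMap T z (t, fun i => (k i : ℝ))) = 0 :=
      (Submodule.Quotient.mk_eq_zero T).mpr hmem
    rw [hq] at h0
    have h1 : ∑ i, k i • b i = 0 := by exact_mod_cast h0
    have := Fintype.linearIndependent_iff.mp b.linearIndependent k h1
    ext i
    simp [this i]
  · intro x hx
    let k := b.repr ⟨T.mkQ x, hLS x hx⟩
    have hk : T.mkQ (latticeMap T z (0, fun i => (k i : ℝ))) = T.mkQ x := by
      rw [hq, b.sum_repr]
    have hmem : x - latticeMap T z (0, fun i => (k i : ℝ)) ∈ T :=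
      (Submodule.Quotient.eq T).mp hk.symm
    refine ⟨(⟨_, hmem⟩, fun i => (k i : ℝ)), ⟨k, rfl⟩, ?_⟩
    simp [latticeMap_apply]

/-- The lift of an approximate subgroup to `T × ℤ^r` is commensurable to the set of points of
`T × ℤ^r` near a vector subspace that meets the kernel of `latticeMap T z` trivially. -/
theorem IsApproxSubgroup.exists_lifted_submodule [FiniteDimensional ℝ E] {L : Set E} (hA : IsApproxSubgroup L)
    {T : Submodule ℝ E} {δ : ℝ} (hδ : 0 < δ) (hTL : ∀ x ∈ T, ‖x‖ < δ → x ∈ L + L)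
    (hT : ∀ x ∈ L + L + (L + L), ‖x‖ < δ → x ∈ T) {r : ℕ} {z : Fin r → E}
    (hz : ∀ x : T × (Fin r → ℝ), x.2 ∈ integerPoints r → latticeMap T z x ∈ T → x.2 = 0)
    (hL : ∀ x ∈ L, ∃ y : T × (Fin r → ℝ), y.2 ∈ integerPoints r ∧ latticeMap T z y = x) :
    ∃ W : Submodule ℝ (T × (Fin r → ℝ)),
      (∃ R : ℝ, ∀ x ∈ L, ∃ y : T × (Fin r → ℝ), y.2 ∈ integerPoints r ∧ latticeMap T z y = x ∧
        ∃ w ∈ W, ‖y - w‖ ≤ R) ∧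
      (∀ R : ℝ, ∃ F : Set E, F.Finite ∧ ∀ y : T × (Fin r → ℝ), y.2 ∈ integerPoints r →
        (∃ w ∈ W, ‖y - w‖ ≤ R) → latticeMap T z y ∈ F + L) ∧
      ∀ w ∈ W, latticeMap T z w = 0 → w = 0 := by
  set p := latticeMap T z with hp
  have hpT : ∀ x : T × (Fin r → ℝ), x.2 = 0 → p x = x.1 := fun x hx => by
    rw [hp, latticeMap_apply, hx]; simp
  have hinj : InjOn p {x | x.2 ∈ integerPoints r} := by
    intro x hx y hy hxy
    have h0 : p (x - y) = 0 := by rw [map_sub, hxy, sub_self]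
    have h2 : (x - y).2 = 0 := hz _ ((integerPoints r).sub_mem hx hy) (by
      rw [h0]; exact T.zero_mem)
    have h1 : (x - y).1 = 0 := by
      rw [hpT _ h2] at h0
      exact_mod_cast h0
    exact sub_eq_zero.mp (Prod.ext h1 h2)
  have hfin : ∀ S : Set E, S.Finite → ∃ M : ℝ, 0 ≤ M ∧ ∀ x : T × (Fin r → ℝ),
      x.2 ∈ integerPoints r → p x ∈ S → ‖x‖ ≤ M := by
    intro S hS
    have hf : ({x | x.2 ∈ integerPoints r} ∩ p ⁻¹' S).Finite :=
      Set.Finite.of_finite_image (hS.subset (by rintro _ ⟨x, hx, rfl⟩; exact hx.2))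
        (hinj.mono inter_subset_left)
    obtain ⟨M, hM⟩ := isBounded_iff_forall_norm_le.mp hf.isBounded
    exact ⟨|M|, abs_nonneg _, fun x hx hxS => (hM x ⟨hx, hxS⟩).trans (le_abs_self M)⟩
  obtain ⟨F, hF, hFL⟩ := hA.exists_finite
  obtain ⟨C, -, hC⟩ := hfin F hF
  obtain ⟨W, R, hW₁, hW₂⟩ := exists_submodule_near
    (A := {x : T × (Fin r → ℝ) | x.2 ∈ integerPoints r ∧ p x ∈ L}) (C := C)
    (fun a ha => ⟨(integerPoints r).neg_mem ha.1, by rw [map_neg]; exact hA.neg_mem ha.2⟩)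
    ⟨(integerPoints r).zero_mem, by rw [map_zero]; exact hA.zero_mem⟩
    (by
      intro a ha b hb
      obtain ⟨f, hf, l, hl, h⟩ := hFL (add_mem_add ha.2 hb.2)
      obtain ⟨c, hc, rfl⟩ := hL l hl
      refine ⟨c, ⟨hc, hl⟩, hC _ ((integerPoints r).sub_mem ((integerPoints r).add_mem ha.1 hb.1) hc) ?_⟩
      rw [map_sub, map_add, ← h]
      simpa [hp] using hf)
  refine ⟨W, ⟨R, fun x hx => ?_⟩, fun R' => ?_, fun w hw hw0 => ?_⟩
  · obtain ⟨y, hy, rfl⟩ := hL x hx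
    exact ⟨y, hy, rfl, hW₁ y ⟨hy, hx⟩⟩
  · have hb : Bornology.IsBounded
        {x : T × (Fin r → ℝ) | x.2 ∈ integerPoints r ∧ ‖x‖ ≤ R' + R} :=
      isBounded_iff_forall_norm_le.mpr ⟨_, fun b hb => hb.2⟩
    -- Below `1` the integer coordinate of a difference vanishes; below `δ` its `T`-coordinate lies
    -- in `L + L`.
    obtain ⟨S, hSs, hSf, hS⟩ := hb.exists_finite_net (ε := min δ 1) (by positivity)
    obtain ⟨F₃, hF₃, hFL₃⟩ := hA.exists_finite_three
    refine ⟨p '' S + F₃, (hSf.image _).add hF₃, ?_⟩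
    rintro y hy ⟨w, hw, hyw⟩
    obtain ⟨a, ha, hwa⟩ := hW₂ w hw
    obtain ⟨s, hs, hys⟩ := hS (y - a) ⟨(integerPoints r).sub_mem hy ha.1, by
      calc ‖y - a‖ = ‖(y - w) + (w - a)‖ := by congr 1; abel
        _ ≤ _ := (norm_add_le _ _).trans (add_le_add hyw hwa)⟩
    have h2 : (y - a - s).2 = 0 := eq_zero_of_mem_integerPoints_of_norm_lt
      ((integerPoints r).sub_mem ((integerPoints r).sub_mem hy ha.1) (hSs hs).1)
      ((norm_snd_le _).trans_lt (hys.trans_le (min_le_right _ _)))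
    have h1 : p (y - a - s) ∈ L + L := by
      rw [hpT _ h2]
      exact hTL _ (Subtype.coe_prop _)
        ((norm_fst_le (y - a - s)).trans_lt (hys.trans_le (min_le_left _ _)))
    have hy' : p y = p s + (p (y - a - s) + p a) := by
      rw [map_sub, map_sub]; abel
    rw [hy', add_assoc]
    exact add_mem_add ⟨s, hs, rfl⟩ (hFL₃ (add_mem_add h1 ha.2))
  · have hpc : ∃ M : ℝ, ∀ x, ‖p x‖ ≤ M * ‖x‖ := ⟨_, p.toContinuousLinearMap.le_opNorm⟩
    obtain ⟨M, hM⟩ := hpc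
    have hb : Bornology.IsBounded {x ∈ L | ‖x‖ ≤ |M| * R} :=
      isBounded_iff_forall_norm_le.mpr ⟨_, fun b hb => hb.2⟩
    obtain ⟨S, hSs, hSf, hS⟩ := hb.exists_finite_net hδ
    obtain ⟨M', hM'0, hM'⟩ := hfin S hSf
    -- Lifted points with bounded image are bounded, because modulo `T` only finitely many classes
    -- occur. A nonzero `w ∈ W` in the kernel would contradict this: lifted points follow its
    -- multiples while their images stay bounded.
    have hbound : ∀ a : T × (Fin r → ℝ), a.2 ∈ integerPoints r → p a ∈ L → ‖p a‖ ≤ |M| * R →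
        ‖a‖ ≤ M' + δ := by
      intro a ha haL han
      obtain ⟨s, hs, has⟩ := hS _ ⟨haL, han⟩
      obtain ⟨c, hc, hcs⟩ := hL s (hSs hs).1
      have hacT : p (a - c) ∈ T := hT _ (by
        rw [map_sub, hcs, sub_eq_add_neg, ← add_zero (p a + -s)]
        exact add_mem_add (add_mem_add haL (hA.neg_mem (hSs hs).1))
          ⟨0, hA.zero_mem, 0, hA.zero_mem, by simp⟩) (by rwa [map_sub, hcs])
      have h2 : (a - c).2 = 0 := hz _ ((integerPoints r).sub_mem ha hc) hacT
      have h1 : ‖a - c‖ ≤ δ := by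
        rw [Prod.norm_def, h2, norm_zero]
        refine max_le ?_ hδ.le
        have := hpT _ h2
        rw [map_sub, hcs] at this
        rw [this] at has
        exact has.le
      calc ‖a‖ = ‖c + (a - c)‖ := by congr 1; abel
        _ ≤ ‖c‖ + ‖a - c‖ := norm_add_le _ _
        _ ≤ M' + δ := add_le_add (hM' c hc (by rwa [hcs])) h1
    by_contra hne
    have hwpos : 0 < ‖w‖ := norm_pos_iff.mpr hne
    obtain ⟨k, hk⟩ := exists_nat_gt ((R + (M' + δ)) / ‖w‖)
    rw [div_lt_iff₀ hwpos] at hk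
    obtain ⟨a, ha, hwa⟩ := hW₂ ((k : ℝ) • w) (W.smul_mem _ hw)
    have hpa : ‖p a‖ ≤ |M| * R := by
      have heq : p a = -p ((k : ℝ) • w - a) := by rw [map_sub, map_smul, hw0]; simp
      rw [heq, norm_neg]
      calc _ ≤ M * ‖(k : ℝ) • w - a‖ := hM _
        _ ≤ |M| * ‖(k : ℝ) • w - a‖ := by gcongr; exact le_abs_self _
        _ ≤ |M| * R := by gcongr
    have h1 := hbound a ha.1 ha.2 hpa
    have h2 : ‖(k : ℝ) • w‖ ≤ ‖(k : ℝ) • w - a‖ + ‖a‖ := by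
      simpa using norm_add_le ((k : ℝ) • w - a) a
    rw [norm_smul, Real.norm_natCast] at h2
    linarith

end Lift

/-! ### Commensurability and compact neighbourhoods. -/

section Commensurable

theorem AreCommensurable.of_finite {E : Type*} [AddGroup E] {X Y F F' : Set E} (hF : F.Finite)
    (hF' : F'.Finite) (hXY : X ⊆ F + Y) (hYX : Y ⊆ F' + X) : AreCommensurable X Y :=
  ⟨F ∪ F', hF.union hF', hXY.trans (by gcongr; exact subset_union_left),
    hYX.trans (by gcongr; exact subset_union_right)⟩

theorem AreCommensurable.refl {E : Type*} [AddGroup E] (X : Set E) : AreCommensurable X X :=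
  ⟨{0}, finite_singleton 0, by simp, by simp⟩

theorem LinearMap.exists_norm_le {X Y : Type*} [NormedAddCommGroup X] [NormedSpace ℝ X]
    [FiniteDimensional ℝ X] [NormedAddCommGroup Y] [NormedSpace ℝ Y] (f : X →ₗ[ℝ] Y) :
    ∃ M : ℝ, 0 ≤ M ∧ ∀ x, ‖f x‖ ≤ M * ‖x‖ :=
  ⟨‖f.toContinuousLinearMap‖, norm_nonneg _, f.toContinuousLinearMap.le_opNorm⟩

variable {E : Type*} [NormedAddCommGroup E] [NormedSpace ℝ E] [FiniteDimensional ℝ E]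

theorem Bornology.IsBounded.subset_finite_add {V : Submodule ℝ E} {K s : Set E}
    (hK : K ∈ 𝓝[(V : Set E)] 0) (hs : Bornology.IsBounded s) (hsV : s ⊆ V) :
    ∃ F : Set E, F.Finite ∧ s ⊆ F + K := by
  obtain ⟨δ, hδ, hball⟩ := Metric.mem_nhdsWithin_iff.mp hK
  obtain ⟨t, hts, htf, ht⟩ := hs.exists_finite_net hδ
  refine ⟨t, htf, fun x hx => ?_⟩
  obtain ⟨y, hy, hxy⟩ := ht x hx
  exact ⟨y, hy, x - y, hball ⟨by simpa using hxy, V.sub_mem (hsV hx) (hsV (hts hy))⟩, by simp⟩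

theorem isApproxSubgroup_of_mem_nhdsWithin {V : Submodule ℝ E} {K : Set E} (hKV : K ⊆ V)
    (hKc : IsCompact K) (hK : K ∈ 𝓝[(V : Set E)] 0) (hneg : -K = K) : IsApproxSubgroup K := by
  obtain ⟨F, hF, h⟩ := (hKc.add hKc).isBounded.subset_finite_add hK
    (by rintro _ ⟨a, ha, b, hb, rfl⟩; exact V.add_mem (hKV ha) (hKV hb))
  exact isApproxSubgroup_of_finite (mem_of_mem_nhdsWithin V.zero_mem hK) hneg hF h

end Commensurable

/-! ### Cut-and-project sets. -/

section CutAndProject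

variable {E : Type*} [NormedAddCommGroup E] [NormedSpace ℝ E] {m : ℕ}
  {W : Submodule ℝ (Fin m → ℝ)}

theorem isApproxSubgroup_image_integerPointsNear (W : Submodule ℝ (Fin m → ℝ))
    (φ : (Fin m → ℝ) →ₗ[ℝ] E) : IsApproxSubgroup (φ '' integerPointsNear W) := by
  obtain ⟨F, hF, h⟩ := exists_finite_integerPointsNear W 2
  refine isApproxSubgroup_of_finite ⟨0, zero_mem_integerPointsNear W, map_zero φ⟩ ?_
    (hF.image φ) ?_
  · ext x
    constructor
    · rintro ⟨y, hy, hyx⟩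
      exact ⟨-y, neg_mem_integerPointsNear hy, by rw [map_neg, hyx, neg_neg]⟩
    · rintro ⟨y, hy, rfl⟩
      exact ⟨-y, neg_mem_integerPointsNear hy, map_neg φ y⟩
  · rw [← image_add, ← image_add]
    refine image_mono ?_
    rintro _ ⟨x, hx, y, hy, rfl⟩
    obtain ⟨h₁, h₂⟩ := add_mem_near hx hy
    exact h _ h₁ h₂

/-- Injectivity on `W` bounds `φ` below there. Hence only finitely many integer points within `2` of
`W`, the distance allowed for differences, have image in the unit ball; removing their nonzero
images isolates `0`. -/
theorem isUniformlyDiscrete_image_integerPointsNear {φ : (Fin m → ℝ) →ₗ[ℝ] E}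
    (hφ : ∀ w ∈ W, φ w = 0 → w = 0) : IsUniformlyDiscrete (φ '' integerPointsNear W) := by
  obtain ⟨M, hM0, hM⟩ := φ.exists_norm_le
  obtain ⟨c, -, hc⟩ := (φ.domRestrict W).exists_antilipschitzWith (by
    rw [LinearMap.ker_eq_bot']
    exact fun w hw => Subtype.ext (hφ w w.2 hw))
  have hcW : ∀ w ∈ W, ‖w‖ ≤ c * ‖φ w‖ := fun w hw => by
    have := hc.le_mul_dist ⟨w, hw⟩ 0
    simpa [dist_eq_norm] using this
  have hfin : {x ∈ (integerPoints m : Set (Fin m → ℝ)) |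
      (∃ w ∈ W, ‖x - w‖ ≤ 2) ∧ ‖φ x‖ < 1}.Finite := by
    refine finite_of_isBounded_of_subset_integerPoints
      (isBounded_iff_forall_norm_le.mpr ⟨c * (1 + M * 2) + 2, ?_⟩) fun x hx => hx.1
    rintro x ⟨-, ⟨w, hw, hxw⟩, hx1⟩
    have h1 : ‖φ w‖ ≤ 1 + M * 2 := by
      calc ‖φ w‖ = ‖φ x - φ (x - w)‖ := by rw [map_sub]; congr 1; abel
        _ ≤ ‖φ x‖ + ‖φ (x - w)‖ := norm_sub_le _ _
        _ ≤ 1 + M * 2 := add_le_add hx1.le ((hM _).trans (by gcongr))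
    calc ‖x‖ = ‖w + (x - w)‖ := by congr 1; abel
      _ ≤ ‖w‖ + ‖x - w‖ := norm_add_le _ _
      _ ≤ c * (1 + M * 2) + 2 := add_le_add ((hcW w hw).trans (by gcongr)) hxw
  refine ⟨Metric.ball 0 1 ∩ (φ '' _ \ {0})ᶜ, Filter.inter_mem (Metric.ball_mem_nhds 0 one_pos)
    ((hfin.image φ).sdiff.isClosed.isOpen_compl.mem_nhds (by simp)), ?_⟩
  ext x
  constructor
  · rintro ⟨⟨a, ⟨y, hy, hya⟩, _, ⟨y', hy', rfl⟩, rfl⟩, hx1, hx2⟩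
    by_contra hx0
    obtain ⟨h₁, h₂⟩ := add_mem_near (neg_mem_integerPointsNear hy) hy'
    have heq : φ (-y + y') = a + φ y' := by rw [map_add, map_neg, hya, neg_neg]
    exact hx2 ⟨⟨-y + y', ⟨h₁, h₂, by rw [heq]; simpa using hx1⟩, heq⟩, hx0⟩
  · rintro rfl
    refine ⟨⟨0, ⟨0, zero_mem_integerPointsNear W, by simp⟩, 0,
      ⟨0, zero_mem_integerPointsNear W, by simp⟩, by simp⟩, by simp, by simp⟩

end CutAndProject

/-! ### Splitting the lifted subspace, and the main theorem. -/

section Splitting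

/-- A subspace of a product is a graph over its second projection, up to its intersection with the
first factor. -/
theorem Submodule.exists_graph {K M N : Type*} [Field K] [AddCommGroup M] [Module K M]
    [AddCommGroup N] [Module K N] (W : Submodule K (M × N)) :
    ∃ θ : N →ₗ[K] M, ∀ w ∈ W, (w.1 - θ w.2, (0 : N)) ∈ W := by
  let f : W →ₗ[K] N := LinearMap.snd K M N ∘ₗ W.subtype
  obtain ⟨s, hs⟩ := f.rangeRestrict.exists_rightInverse_of_surjective f.range_rangeRestrict
  obtain ⟨θ, hθ⟩ := LinearMap.exists_extend (LinearMap.fst K M N ∘ₗ W.subtype ∘ₗ s)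
  refine ⟨θ, fun w hw => ?_⟩
  let y : LinearMap.range f := f.rangeRestrict ⟨w, hw⟩
  have h1 : θ w.2 = (s y : M × N).1 := LinearMap.congr_fun hθ y
  have h2 : (s y : M × N).2 = w.2 := congrArg Subtype.val (LinearMap.congr_fun hs y)
  have := W.sub_mem hw (s y).2
  rw [h1]
  convert this using 1
  exact Prod.ext rfl (by simp [h2])

theorem Submodule.sub_projectionOnto_mem {K M : Type*} [Field K] [AddCommGroup M] [Module K M]
    {V U : Submodule K M} (h : IsCompl V U) (x : M) :
    x - (V.projectionOnto U h x : M) ∈ U := by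
  rw [← Submodule.projectionOnto_apply_eq_zero_iff h, map_sub, sub_eq_zero]
  exact (Submodule.projectionOnto_apply_left h _).symm

variable {E : Type*} [NormedAddCommGroup E] [InnerProductSpace ℝ E] [FiniteDimensional ℝ E]

/-- A closed approximate subgroup is commensurable to the sum of a vector subspace, a linear
image of the integer points near a subspace, and any compact neighbourhood of `0` in a subspace. -/
theorem IsApproxSubgroup.exists_splitting {L : Set E} (hA : IsApproxSubgroup L)
    (hL : IsClosed L) :
    ∃ (Vo Vd Ve : Submodule ℝ E) (m : ℕ) (φ : (Fin m → ℝ) →ₗ[ℝ] Vd)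
      (W : Submodule ℝ (Fin m → ℝ)),
      IsCompl Vo Vd ∧ Ve ≤ Vd ∧ (∀ w ∈ W, φ w = 0 → w = 0) ∧
      (∀ x ∈ integerPoints m, (φ x : E) ∈ Ve → x = 0) ∧
      ∀ K : Set E, K ⊆ Ve → IsCompact K → K ∈ 𝓝[(Ve : Set E)] 0 →
        AreCommensurable L ((Vo : Set E) + (fun x => (φ x : E)) '' integerPointsNear W + K) := by
  obtain ⟨T, δ, hδ, hTL, hLT⟩ := hA.exists_tangentSpace hL
  obtain ⟨S, hS, hLS⟩ := hA.exists_fg_quotient hδ hLT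
  obtain ⟨m, z, hz, hLz⟩ := exists_basis_of_fg_quotient hS hLS
  obtain ⟨Q, ⟨R, hQ₁⟩, hQ₂, hQ₃⟩ := hA.exists_lifted_submodule hδ hTL hLT hz hLz
  obtain ⟨θ, hθ⟩ := Q.exists_graph
  let Vo : Submodule ℝ E := (Q.comap (LinearMap.inl ℝ T (Fin m → ℝ))).map T.subtype
  have hVo : ∀ t : T, (t : E) ∈ Vo ↔ (t, (0 : Fin m → ℝ)) ∈ Q := fun t => by
    simp [Vo]
  have hVoT : Vo ≤ T := Submodule.map_subtype_le _ _
  obtain ⟨Vd, hVd⟩ := Vo.exists_isCompl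
  let q : E →ₗ[ℝ] Vd := Vd.projectionOnto Vo hVd.symm
  have hq : ∀ x, x - (q x : E) ∈ Vo := Submodule.sub_projectionOnto_mem hVd.symm
  let φ : (Fin m → ℝ) →ₗ[ℝ] Vd :=
    q ∘ₗ latticeMap T z ∘ₗ LinearMap.prod θ LinearMap.id
  -- Projecting to `Vd` only changes the `T`-coordinate, and only by an element of `Vo`.
  have hφ : ∀ x, ∃ t : T, (φ x : E) = latticeMap T z (t, x) ∧ (t - θ x, (0 : Fin m → ℝ)) ∈ Q := by
    intro x
    have ho := hq (latticeMap T z (θ x, x))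
    set o : T := ⟨_, hVoT ho⟩ with ho'
    refine ⟨θ x - o, ?_, ?_⟩
    · have : (φ x : E) = latticeMap T z (θ x, x) - o := by
        simp only [ho', sub_sub_cancel]; rfl
      rw [this, latticeMap_apply, latticeMap_apply]
      simp only [Submodule.coe_sub]
      abel
    · have : (-o : T) = θ x - o - θ x := by abel
      rw [← this, ← hVo]
      exact Vo.neg_mem ho
  let W : Submodule ℝ (Fin m → ℝ) := Q.map (LinearMap.snd ℝ T (Fin m → ℝ))
  obtain ⟨M, hM0, hM⟩ := θ.exists_norm_le
  obtain ⟨N, hN0, hN⟩ := q.exists_norm_le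
  refine ⟨Vo, Vd, Vd ⊓ T, m, φ, W, hVd, inf_le_left, ?_, ?_, fun K hKV hKc hK => ?_⟩
  · rintro _ ⟨w, hw, rfl⟩ h0
    obtain ⟨t, ht, htQ⟩ := hφ w.2
    have hmem : (t, w.2) ∈ Q := by
      have := Q.add_mem (Q.sub_mem htQ (hθ w hw)) hw
      convert this using 1
      exact Prod.ext (by simp) (by simp)
    have h0' : (φ w.2 : E) = 0 := congrArg Subtype.val h0
    exact congrArg Prod.snd (hQ₃ _ hmem (ht ▸ h0'))
  · intro x hx hxT
    obtain ⟨t, ht, -⟩ := hφ x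
    rw [ht] at hxT
    exact hz (t, x) hx hxT.2
  · obtain ⟨F₁, hF₁, hW₁⟩ := exists_finite_integerPointsNear W R
    have hb : Bornology.IsBounded {x : E | x ∈ Vd ⊓ T ∧ ‖x‖ ≤ N * (R + M * R)} :=
      isBounded_iff_forall_norm_le.mpr ⟨_, fun b hb => hb.2⟩
    obtain ⟨F₂, hF₂, hK₂⟩ := hb.subset_finite_add hK fun x hx => hx.1
    obtain ⟨C, hC⟩ := isBounded_iff_forall_norm_le.mp hKc.isBounded
    obtain ⟨F₃, hF₃, hL₃⟩ := hQ₂ (C + M + 1)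
    refine AreCommensurable.of_finite ((hF₁.image fun x => (φ x : E)).add hF₂) hF₃ ?_ ?_
    · intro x hx
      obtain ⟨⟨t, k⟩, hk, rfl, w, hw, hyw⟩ := hQ₁ x hx
      have hyw₁ : ‖t - w.1‖ ≤ R := (norm_fst_le ((t, k) - w)).trans hyw
      have hyw₂ : ‖k - w.2‖ ≤ R := (norm_snd_le ((t, k) - w)).trans hyw
      obtain ⟨f, hf, k', hk', hfk⟩ := hW₁ k hk ⟨w.2, ⟨w, hw, rfl⟩, hyw₂⟩
      obtain ⟨t', ht', htQ'⟩ := hφ k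
      -- The deviation of `(t, k)` from the graph of `θ`, modulo `Vo`. Its part along `Vo` joins the
      -- `Vo` summand, and `q τ` is a bounded element of `Ve`.
      set τ : T := (t - w.1) - θ (k - w.2) with hτ
      have hτR : ‖τ‖ ≤ R + M * R :=
        (norm_sub_le _ _).trans (add_le_add hyw₁ ((hM _).trans (by gcongr)))
      have ho : ((w.1 - θ w.2 - (t' - θ k) : T) : E) ∈ Vo := by
        rw [hVo]
        have := Q.sub_mem (hθ w hw) htQ'
        simpa using this
      have hqτ : (q τ : E) ∈ {x : E | x ∈ Vd ⊓ T ∧ ‖x‖ ≤ N * (R + M * R)} := by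
        refine ⟨⟨(q τ).2, ?_⟩, (hN _).trans (by gcongr; exact hτR)⟩
        have := T.sub_mem τ.2 (hVoT (hq τ))
        rwa [sub_sub_cancel] at this
      obtain ⟨g, hg, κ, hκ, hgκ⟩ := hK₂ hqτ
      have hsum : latticeMap T z (t, k) = (φ f + g) +
          ((((w.1 - θ w.2 - (t' - θ k) : T) : E) + (τ - q τ)) + φ k' + κ) := by
        have h1 : (φ f : E) + φ k' = latticeMap T z (t', k) := by
          rw [← ht', ← hfk]; simp
        have h2 : latticeMap T z (t, k) = latticeMap T z (t', k) + (t - t' : T) := by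
          rw [latticeMap_apply, latticeMap_apply, Submodule.coe_sub]
          abel
        have h3 : (t - t' : T) = (w.1 - θ w.2 - (t' - θ k)) + τ := by
          rw [hτ, map_sub]; abel
        rw [h2, ← h1, h3, Submodule.coe_add]
        simp only at hgκ
        rw [← hgκ]
        abel
      rw [hsum]
      exact add_mem_add (add_mem_add ⟨f, hf, rfl⟩ hg)
        (add_mem_add (add_mem_add (Vo.add_mem ho (hq τ)) ⟨k', hk', rfl⟩) hκ)
    · rintro _ ⟨_, ⟨o, ho, _, ⟨k, hk, rfl⟩, rfl⟩, κ, hκ, rfl⟩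
      obtain ⟨hki, _, ⟨w, hw, rfl⟩, hkw⟩ := mem_integerPointsNear_iff.mp hk
      obtain ⟨t', ht', htQ'⟩ := hφ k
      let o' : T := ⟨o, hVoT ho⟩
      have hoQ : (o', (0 : Fin m → ℝ)) ∈ Q := (hVo o').mp ho
      let c : T := ⟨κ, (hKV hκ).2⟩
      have hc : ‖c‖ ≤ C := hC κ hκ
      have hsum : o + φ k + κ = latticeMap T z (o' + t' + c, k) := by
        rw [ht', latticeMap_apply, latticeMap_apply]
        simp only [Submodule.coe_add, o', c]
        abel
      change o + φ k + κ ∈ F₃ + L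
      rw [hsum]
      refine hL₃ _ hki ⟨_, Q.add_mem (Q.add_mem (Q.sub_mem hw (hθ w hw)) htQ') hoQ, ?_⟩
      -- The nearby point of `Q` has second coordinate `w.2`, leaving an error of at most `C + M` in
      -- `T` and `1` in `ℝ^m`.
      have hdiff : (o' + t' + c, k) - (w - (w.1 - θ w.2, 0) + (t' - θ k, 0) + (o', 0)) =
          (c + θ (k - w.2), k - w.2) := by
        refine Prod.ext ?_ ?_
        · simp only [Prod.fst_sub, Prod.fst_add, map_sub]; abel
        · simp
      rw [hdiff, Prod.norm_def]
      have hkw' : ‖k - w.2‖ ≤ 1 := hkw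
      have hC0 : 0 ≤ C := (norm_nonneg _).trans hc
      refine max_le ?_ (by simp only; linarith)
      refine (norm_add_le _ _).trans ?_
      have : ‖θ (k - w.2)‖ ≤ M * 1 := (hM _).trans (by gcongr)
      linarith

end Splitting

theorem mainTheorem10 (n : ℕ) (L : Set (EuclideanSpace ℝ (Fin n)))
    (hclosed : IsClosed L) (happrox : IsApproxSubgroup L) :
    ∃ (Vo Vd Ve : Submodule ℝ (EuclideanSpace ℝ (Fin n)))
      (D : Set (EuclideanSpace ℝ (Fin n))),
      IsCompl Vo Vd ∧
      D ⊆ (Vd : Set (EuclideanSpace ℝ (Fin n))) ∧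
      IsApproxSubgroup D ∧ IsUniformlyDiscrete D ∧
      (∃ K : Set (EuclideanSpace ℝ (Fin n)),
        K ⊆ (Vd : Set (EuclideanSpace ℝ (Fin n))) ∧ IsCompact K ∧ IsApproxSubgroup K ∧
        AreCommensurable L ((Vo : Set (EuclideanSpace ℝ (Fin n))) + D + K)) ∧
      -- the compact factor can be any compact neighbourhood of `0` in `Ve`
      Ve ≤ Vd ∧
      (Ve : Set (EuclideanSpace ℝ (Fin n))) ∩ (D + D) = {0} ∧
      (∀ K : Set (EuclideanSpace ℝ (Fin n)),
        K ⊆ (Ve : Set (EuclideanSpace ℝ (Fin n))) → IsCompact K →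
        K ∈ 𝓝[(Ve : Set (EuclideanSpace ℝ (Fin n)))] 0 →
        (-K = K → IsApproxSubgroup K) ∧
        AreCommensurable L ((Vo : Set (EuclideanSpace ℝ (Fin n))) + D + K)) ∧
      -- the discrete factor is of cut-and-project type
      (∃ (m : ℕ) (φ : (Fin m → ℝ) →ₗ[ℝ] Vd) (W : Submodule ℝ (Fin m → ℝ)),
        W ⊓ LinearMap.ker φ = ⊥ ∧
        D ⊆ (fun x => (φ x : EuclideanSpace ℝ (Fin n))) '' integerPointsNear W ∧
        AreCommensurable D
          ((fun x => (φ x : EuclideanSpace ℝ (Fin n))) '' integerPointsNear W)) := by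
  obtain ⟨Vo, Vd, Ve, m, φ, W, hcompl, hVe, hker, hdisj, hcomm⟩ := happrox.exists_splitting hclosed
  let ψ : (Fin m → ℝ) →ₗ[ℝ] EuclideanSpace ℝ (Fin n) := Vd.subtype ∘ₗ φ
  have hball : Metric.closedBall 0 1 ∩ (Ve : Set (EuclideanSpace ℝ (Fin n))) ∈
      𝓝[(Ve : Set (EuclideanSpace ℝ (Fin n)))] 0 :=
    Filter.inter_mem (mem_nhdsWithin_of_mem_nhds (Metric.closedBall_mem_nhds 0 one_pos))
      self_mem_nhdsWithin
  have hballc : IsCompact (Metric.closedBall 0 1 ∩ (Ve : Set (EuclideanSpace ℝ (Fin n)))) :=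
    (isCompact_closedBall 0 1).inter_right Ve.closed_of_finiteDimensional
  refine ⟨Vo, Vd, Ve, (fun x => (φ x : EuclideanSpace ℝ (Fin n))) '' integerPointsNear W, hcompl,
    ?_, isApproxSubgroup_image_integerPointsNear W ψ,
    isUniformlyDiscrete_image_integerPointsNear (φ := ψ)
      fun w hw h => hker w hw (Subtype.ext h),
    ⟨_, inter_subset_right.trans hVe, hballc,
      isApproxSubgroup_of_mem_nhdsWithin inter_subset_right hballc hball ?_,
      hcomm _ inter_subset_right hballc hball⟩, hVe, ?_,
    fun K hKV hKc hK => ⟨isApproxSubgroup_of_mem_nhdsWithin hKV hKc hK, hcomm K hKV hKc hK⟩,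
    m, φ, W, ?_, subset_rfl, AreCommensurable.refl _⟩
  · rintro _ ⟨x, -, rfl⟩
    exact (φ x).2
  · ext x
    simp
  · ext x
    constructor
    · rintro ⟨hx, _, ⟨k, hk, rfl⟩, _, ⟨k', hk', rfl⟩, rfl⟩
      -- `k + k'` is again an integer point, and `φ` sends no nonzero integer point into `Ve`.
      have hadd : (φ (k + k') : EuclideanSpace ℝ (Fin n)) = φ k + φ k' := by simp
      have h0 := hdisj _ (add_mem_near hk hk').1 (by rw [hadd]; exact hx)
      rw [h0] at hadd
      simpa using hadd.symm
    · rintro rfl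
      exact ⟨Ve.zero_mem, 0, ⟨0, zero_mem_integerPointsNear W, by simp⟩, 0,
        ⟨0, zero_mem_integerPointsNear W, by simp⟩, by simp⟩
  · rw [eq_bot_iff]
    rintro w ⟨hw, hw0⟩
    exact hker w hw hw0
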